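/- Let $\mathfrak K$ be the set of compact metric spaces $(X,d_X,\nu_X)$ equipped with a Borel probability measure, where two such spaces are identified if there is a measure-preserving bijective isometry between them. Endow $\mathfrak K$ with the Gromov–Hausdorff–Prokhorov distance $$d_{\mathrm{GHP}}(X,Y)=\inf_{E,\varphi,\psi}\max\bigl(d_{\mathrm H}(\varphi(X),\psi(Y)),\,d_{\mathrm P}(\nu_X\circ\varphi^{-1},\nu_Y\circ\psi^{-1})\bigr),$$ where the infimum ranges over all isometric embeddings $\varphi:X\to E$, $\psi:Y\to E$ into a common metric space $E$, and $d_{\mathrm H}$, $d_{\mathrm P}$ are the Hausdorff and the Prokhorov distance; a random element of $\mathfrak K$ is a random variable with values in $\mathfrak K$ with its Borel $\sigma$-algebra. For $\delta>0$ let $\lambda_\delta^X=\sup_{x\in X}\nu_X(\{y\in X: d_X(x,y)<\delta\})$. Let $(\mathsf X_n,d_{\mathsf X_n},\nu_{\mathsf X_n})_{n\ge1}$ and $(\mathsf X,d_{\mathsf X},\nu_{\mathsf X})$ be random elements of $\mathfrak K$ such that $\mathsf X_n$ converges in distribution to $\mathsf X$ as $n\to\infty$. Then the following two statements are equivalent: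 1. Almost surely there is no $x\in\mathsf X$ with $\nu_{\mathsf X}(\{x\})>0$. 2. For all $\varepsilon,\varepsilon'>0$ there exist $\delta>0$ and $N>0$ such that $\mathbb P(\lambda_\delta^{\mathsf X_n}>\varepsilon)<\varepsilon'$ for all $n\ge N$. -/

import Mathlib

open Set Filter Topology MeasureTheory ProbabilityTheory

universe u

/-- A compact metric space endowed with a Borel probability measure. -/
structure CompactMetricProbSpace : Type (u + 1) where
  carrier : Type u
  [metricSpace : MetricSpace carrier]
  [compactSpace : CompactSpace carrier]
  [measurableSpace : MeasurableSpace carrier]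
  [borelSpace : BorelSpace carrier]
  measure : Measure carrier
  [isProbabilityMeasure : IsProbabilityMeasure measure]

namespace CompactMetricProbSpace

instance : CoeSort CompactMetricProbSpace.{u} (Type u) := ⟨carrier⟩

attribute [instance] metricSpace compactSpace measurableSpace borelSpace isProbabilityMeasure

instance (X : CompactMetricProbSpace.{u}) : Nonempty X :=
  nonempty_of_isProbabilityMeasure X.measure

/-- The largest mass `sup_x ν(B_δ(x))` of an open ball of radius `δ`. -/
noncomputable def largestBallMass (δ : ℝ) (X : CompactMetricProbSpace.{u}) : ℝ :=
  ⨆ x : X, X.measure.real (Metric.ball x δ)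

/-- No point carries positive mass. -/
def IsNonatomic (X : CompactMetricProbSpace.{u}) : Prop :=
  ¬ ∃ x : X, 0 < X.measure {x}

/-- `r` is the larger one of the Hausdorff distance of the images and of the Prokhorov distance of
the push-forward measures, for some isometric embeddings of `X` and `Y` into some common metric
space `E` (with its Borel sigma-algebra). -/
def IsEmbeddingDist (X Y : CompactMetricProbSpace.{u}) (r : ℝ) : Prop :=
  ∃ (E : Type u) (_ : MetricSpace E) (_ : MeasurableSpace E) (_ : BorelSpace E)
    (φ : X → E) (ψ : Y → E), Isometry φ ∧ Isometry ψ ∧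
      r = max (Metric.hausdorffDist (range φ) (range ψ))
        (levyProkhorovDist (X.measure.map φ) (Y.measure.map ψ))

/-- The Gromov-Hausdorff-Prokhorov distance. -/
noncomputable def ghpDist (X Y : CompactMetricProbSpace.{u}) : ℝ :=
  sInf {r : ℝ | IsEmbeddingDist X Y r}

/-- Two compact metric probability spaces are identified if there is a measure-preserving
bijective isometry between them. -/
instance isoSetoid : Setoid CompactMetricProbSpace.{u} where
  r X Y := ∃ e : X ≃ᵢ Y, MeasurePreserving e X.measure Y.measure
  iseqv :=
    { refl := fun X => ⟨IsometryEquiv.refl X, MeasurePreserving.id _⟩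
      symm := by
        rintro X Y ⟨e, he⟩
        exact ⟨e.symm, MeasurePreserving.symm e.toHomeomorph.toMeasurableEquiv he⟩
      trans := by
        rintro X Y Z ⟨e, he⟩ ⟨f, hf⟩
        exact ⟨e.trans f, hf.comp he⟩ }

theorem largestBallMass_congr (δ : ℝ) {X Y : CompactMetricProbSpace.{u}} (h : X ≈ Y) :
    largestBallMass δ X = largestBallMass δ Y := by
  obtain ⟨e, he⟩ := h
  unfold largestBallMass
  refine Equiv.iSup_congr e.toEquiv fun x => ?_
  have h1 := he.measure_preimage
    (Metric.isOpen_ball (x := e x) (ε := δ)).measurableSet.nullMeasurableSet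
  rw [e.isometry.preimage_ball] at h1
  exact congrArg ENNReal.toReal h1.symm

theorem isNonatomic_congr {X Y : CompactMetricProbSpace.{u}} (h : X ≈ Y) :
    IsNonatomic X = IsNonatomic Y := by
  obtain ⟨e, he⟩ := h
  have key : ∀ x : X, X.measure {x} = Y.measure {e x} := fun x => by
    have h1 := he.measure_preimage (measurableSet_singleton (e x)).nullMeasurableSet
    rw [← image_singleton, e.injective.preimage_image] at h1
    rw [h1, image_singleton]
  unfold IsNonatomic
  simp only [key]
  rw [e.surjective.exists (p := fun y => 0 < Y.measure {y})]

theorem isEmbeddingDist_comm {X Y : CompactMetricProbSpace.{u}} {r : ℝ}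
    (h : IsEmbeddingDist X Y r) : IsEmbeddingDist Y X r := by
  obtain ⟨E, i1, i2, i3, φ, ψ, hφ, hψ, rfl⟩ := h
  exact ⟨E, i1, i2, i3, ψ, φ, hψ, hφ, by
    rw [Metric.hausdorffDist_comm, levyProkhorovDist_comm]⟩

theorem isEmbeddingDist_congr {X X' Y : CompactMetricProbSpace.{u}} {r : ℝ} (hX : X ≈ X')
    (h : IsEmbeddingDist X' Y r) : IsEmbeddingDist X Y r := by
  obtain ⟨e, he⟩ := hX
  obtain ⟨E, i1, i2, i3, φ, ψ, hφ, hψ, rfl⟩ := h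
  refine ⟨E, i1, i2, i3, φ ∘ e, ψ, hφ.comp e.isometry, hψ, ?_⟩
  rw [e.surjective.range_comp, ← Measure.map_map hφ.continuous.measurable he.measurable, he.map_eq]

theorem ghpDist_comm (X Y : CompactMetricProbSpace.{u}) : ghpDist X Y = ghpDist Y X := by
  unfold ghpDist
  congr 1
  ext r
  exact ⟨isEmbeddingDist_comm, isEmbeddingDist_comm⟩

theorem ghpDist_congr {X Y X' Y' : CompactMetricProbSpace.{u}} (hX : X ≈ X') (hY : Y ≈ Y') :
    ghpDist X Y = ghpDist X' Y' := by
  have aux : ∀ {A A' B : CompactMetricProbSpace.{u}}, A ≈ A' → ghpDist A B = ghpDist A' B := by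
    intro A A' B h
    unfold ghpDist
    congr 1
    ext r
    exact ⟨isEmbeddingDist_congr (Setoid.symm h), isEmbeddingDist_congr h⟩
  rw [aux hX, ghpDist_comm, aux hY, ghpDist_comm]

theorem isEmbeddingDist_nonneg {X Y : CompactMetricProbSpace.{u}} {r : ℝ}
    (h : IsEmbeddingDist X Y r) : 0 ≤ r := by
  obtain ⟨E, i1, i2, i3, φ, ψ, hφ, hψ, rfl⟩ := h
  exact le_max_of_le_left Metric.hausdorffDist_nonneg

theorem bddBelow_embeddingDist (X Y : CompactMetricProbSpace.{u}) :
    BddBelow {r : ℝ | IsEmbeddingDist X Y r} :=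
  ⟨0, fun _ h => isEmbeddingDist_nonneg h⟩

theorem exists_isEmbeddingDist (X Y : CompactMetricProbSpace.{u}) :
    {r : ℝ | IsEmbeddingDist X Y r}.Nonempty := by
  let _ : MetricSpace (X ⊕ Y) := Metric.metricSpaceSum
  let _ : MeasurableSpace (X ⊕ Y) := borel _
  have _ : BorelSpace (X ⊕ Y) := ⟨rfl⟩
  exact ⟨_, X ⊕ Y, _, _, inferInstance, Sum.inl, Sum.inr, Metric.isometry_inl, Metric.isometry_inr,
    rfl⟩

theorem ghpDist_self (X : CompactMetricProbSpace.{u}) : ghpDist X X = 0 := by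
  refine le_antisymm (csInf_le (bddBelow_embeddingDist X X) ?_)
    (le_csInf (exists_isEmbeddingDist X X) fun _ h => isEmbeddingDist_nonneg h)
  exact ⟨X, _, _, inferInstance, id, id, isometry_id, isometry_id, by
    rw [Metric.hausdorffDist_self_zero, levyProkhorovDist_self, max_self]⟩

theorem levyProkhorovDist_map_le {E F : Type u} [MetricSpace E] [MeasurableSpace E] [BorelSpace E]
    [MetricSpace F] [MeasurableSpace F] [BorelSpace F] {f : E → F} (hf : Isometry f)
    (μ ν : Measure E) [IsFiniteMeasure μ] [IsFiniteMeasure ν] :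
    levyProkhorovDist (μ.map f) (ν.map f) ≤ levyProkhorovDist μ ν := by
  refine ENNReal.toReal_mono (levyProkhorovEDist_ne_top μ ν) (sInf_le_sInf fun ε hε B hB => ?_)
  have hm : Measurable f := hf.continuous.measurable
  have hsub : Metric.thickening ε.toReal (f ⁻¹' B) ⊆ f ⁻¹' (Metric.thickening ε.toReal B) := by
    intro x hx
    rw [Metric.mem_thickening_iff] at hx
    obtain ⟨z, hz, hxz⟩ := hx
    exact Metric.mem_thickening_iff.2 ⟨f z, hz, by rwa [hf.dist_eq]⟩
  rw [Measure.map_apply hm hB, Measure.map_apply hm hB,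
    Measure.map_apply hm Metric.isOpen_thickening.measurableSet,
    Measure.map_apply hm Metric.isOpen_thickening.measurableSet]
  obtain ⟨h1, h2⟩ := hε _ (hm hB)
  exact ⟨h1.trans (add_le_add (measure_mono hsub) le_rfl),
    h2.trans (add_le_add (measure_mono hsub) le_rfl)⟩

theorem exists_isEmbeddingDist_le_add {X Y Z : CompactMetricProbSpace.{u}} {r s : ℝ}
    (hr : IsEmbeddingDist X Y r) (hs : IsEmbeddingDist Y Z s) :
    ∃ t, IsEmbeddingDist X Z t ∧ t ≤ r + s := by
  obtain ⟨E, i1, i2, i3, φ, ψ, hφ, hψ, rfl⟩ := hr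
  obtain ⟨F, j1, j2, j3, φ', ψ', hφ', hψ', rfl⟩ := hs
  let _ : MeasurableSpace (Metric.GlueSpace hψ hφ') := borel _
  have _ : BorelSpace (Metric.GlueSpace hψ hφ') := ⟨rfl⟩
  have hL := Metric.toGlueL_isometry hψ hφ'
  have hR := Metric.toGlueR_isometry hψ hφ'
  have hcomm := Metric.toGlue_commute hψ hφ'
  set L := Metric.toGlueL hψ hφ'
  set R := Metric.toGlueR hψ hφ'
  refine ⟨_, ⟨_, _, _, inferInstance, L ∘ φ, R ∘ ψ', hL.comp hφ, hR.comp hψ', rfl⟩, ?_⟩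
  have m1 := hφ.continuous.measurable
  have m2 := hψ.continuous.measurable
  have m3 := hφ'.continuous.measurable
  have m4 := hψ'.continuous.measurable
  have mL := hL.continuous.measurable
  have mR := hR.continuous.measurable
  have _ : IsProbabilityMeasure (X.measure.map φ) :=
    Measure.isProbabilityMeasure_map m1.aemeasurable
  have _ : IsProbabilityMeasure (Y.measure.map ψ) :=
    Measure.isProbabilityMeasure_map m2.aemeasurable
  have _ : IsProbabilityMeasure (Y.measure.map φ') :=
    Measure.isProbabilityMeasure_map m3.aemeasurable
  have _ : IsProbabilityMeasure (Z.measure.map ψ') :=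
    Measure.isProbabilityMeasure_map m4.aemeasurable
  have _ : IsProbabilityMeasure ((X.measure.map φ).map L) :=
    Measure.isProbabilityMeasure_map mL.aemeasurable
  have _ : IsProbabilityMeasure ((Y.measure.map ψ).map L) :=
    Measure.isProbabilityMeasure_map mL.aemeasurable
  have _ : IsProbabilityMeasure ((Z.measure.map ψ').map R) :=
    Measure.isProbabilityMeasure_map mR.aemeasurable
  have hY : (Y.measure.map ψ).map L = (Y.measure.map φ').map R := by
    rw [Measure.map_map mL m2, Measure.map_map mR m3, hcomm]
  have hrange : L '' range ψ = R '' range φ' := by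
    rw [← range_comp, ← range_comp, hcomm]
  have hP : levyProkhorovDist (X.measure.map (L ∘ φ)) (Z.measure.map (R ∘ ψ')) ≤
      levyProkhorovDist (X.measure.map φ) (Y.measure.map ψ) +
        levyProkhorovDist (Y.measure.map φ') (Z.measure.map ψ') := by
    rw [← Measure.map_map mL m1, ← Measure.map_map mR m4]
    refine (levyProkhorovDist_triangle _ ((Y.measure.map ψ).map L) _).trans
      (add_le_add (levyProkhorovDist_map_le hL _ _) ?_)
    rw [hY]
    exact levyProkhorovDist_map_le hR _ _
  have hH : Metric.hausdorffDist (range (L ∘ φ)) (range (R ∘ ψ')) ≤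
      Metric.hausdorffDist (range φ) (range ψ) + Metric.hausdorffDist (range φ') (range ψ') := by
    rw [range_comp, range_comp, ← Metric.hausdorffDist_image hL (s := range φ),
      ← Metric.hausdorffDist_image hR (s := range φ'), hrange]
    refine Metric.hausdorffDist_triangle ?_
    rw [← hrange]
    exact Metric.hausdorffEDist_ne_top_of_nonempty_of_bounded
      ((range_nonempty φ).image L) ((range_nonempty ψ).image L)
      ((isCompact_range hφ.continuous).image hL.continuous).isBounded
      ((isCompact_range hψ.continuous).image hL.continuous).isBounded
  exact max_le (hH.trans (add_le_add (le_max_left _ _) (le_max_left _ _)))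
    (hP.trans (add_le_add (le_max_right _ _) (le_max_right _ _)))

theorem ghpDist_triangle (X Y Z : CompactMetricProbSpace.{u}) :
    ghpDist X Z ≤ ghpDist X Y + ghpDist Y Z := by
  refine le_of_forall_pos_lt_add fun ε hε => ?_
  obtain ⟨r, hr, hr'⟩ := exists_lt_of_csInf_lt (exists_isEmbeddingDist X Y)
    (lt_add_of_pos_right (ghpDist X Y) (half_pos hε))
  obtain ⟨s, hs, hs'⟩ := exists_lt_of_csInf_lt (exists_isEmbeddingDist Y Z)
    (lt_add_of_pos_right (ghpDist Y Z) (half_pos hε))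
  obtain ⟨t, ht, hle⟩ := exists_isEmbeddingDist_le_add hr hs
  have := csInf_le (bddBelow_embeddingDist X Z) ht
  change ghpDist X Z ≤ t at this
  linarith

end CompactMetricProbSpace

/-- The space `𝔎` of compact metric spaces endowed with a Borel probability measure, up to
measure-preserving isometry. -/
def GHPSpace : Type (u + 1) := Quotient CompactMetricProbSpace.isoSetoid.{u}

namespace GHPSpace

/-- The Gromov-Hausdorff-Prokhorov distance on `𝔎`. The instance provides the topology on `𝔎`. -/
noncomputable instance : PseudoMetricSpace GHPSpace.{u} where
  dist := Quotient.lift₂ CompactMetricProbSpace.ghpDist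
    fun _ _ _ _ hX hY => CompactMetricProbSpace.ghpDist_congr hX hY
  dist_self := by
    rintro ⟨X⟩
    exact CompactMetricProbSpace.ghpDist_self X
  dist_comm := by
    rintro ⟨X⟩ ⟨Y⟩
    exact CompactMetricProbSpace.ghpDist_comm X Y
  dist_triangle := by
    rintro ⟨X⟩ ⟨Y⟩ ⟨Z⟩
    exact CompactMetricProbSpace.ghpDist_triangle X Y Z

noncomputable instance : MeasurableSpace GHPSpace.{u} := borel _

instance : BorelSpace GHPSpace.{u} := ⟨rfl⟩

/-- The largest mass `λ_δ` of an open ball of radius `δ`. -/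
noncomputable def largestBallMass (δ : ℝ) : GHPSpace.{u} → ℝ :=
  Quotient.lift (CompactMetricProbSpace.largestBallMass δ)
    fun _ _ h => CompactMetricProbSpace.largestBallMass_congr δ h

/-- No point carries positive mass. -/
def IsNonatomic : GHPSpace.{u} → Prop :=
  Quotient.lift CompactMetricProbSpace.IsNonatomic
    fun _ _ h => CompactMetricProbSpace.isNonatomic_congr h

end GHPSpace

/-! By compactness, a space has no atom iff its largest ball mass `λ_δ` tends to 0 as `δ → 0`, so
statement 2 is a version of statement 1 that is uniform along the sequence. The transfer is the
portmanteau theorem. The function `λ_δ` need not be continuous on `𝔎`, but spaces at distance less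
than `η` satisfy `λ_δ(X) ≤ λ_{δ+2η}(Y) + η` (`largestBallMass_le_add_of_ghpDist_lt`). Hence the
closure and the interior of a set `{λ_δ > ε}` are controlled by such sets with slightly different
parameters. The closed-set bound then gives 1 ⇒ 2 and the open-set bound gives 2 ⇒ 1. Only
inclusions are used, so `{λ_δ > ε}` itself need not be shown measurable. -/

namespace CompactMetricProbSpace

/-! ### Ball masses of individual spaces. -/

theorem measureReal_ball_le_largestBallMass (δ : ℝ) (X : CompactMetricProbSpace.{u}) (x : X) :
    X.measure.real (Metric.ball x δ) ≤ largestBallMass δ X :=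
  le_ciSup (f := fun x : X => X.measure.real (Metric.ball x δ))
    ⟨1, by rintro _ ⟨y, rfl⟩; exact measureReal_le_one⟩ x

theorem largestBallMass_mono {δ δ' : ℝ} (h : δ ≤ δ') (X : CompactMetricProbSpace.{u}) :
    largestBallMass δ X ≤ largestBallMass δ' X :=
  ciSup_le fun x => (measureReal_mono (Metric.ball_subset_ball h)).trans
    (measureReal_ball_le_largestBallMass δ' X x)

/-- In a common embedding, `x` has some `y` within `η`. The radius grows by `η` for the Prokhorov
thickening and by `η` for moving the centre from `x` to `y`; the additive `η` is the Prokhorov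
error. -/
theorem largestBallMass_le_add_of_ghpDist_lt {X Y : CompactMetricProbSpace.{u}} {δ δ' η : ℝ}
    (h : ghpDist X Y < η) (hδ : δ + 2 * η ≤ δ') :
    largestBallMass δ X ≤ largestBallMass δ' Y + η := by
  obtain ⟨_, ⟨E, _, _, _, φ, ψ, hφ, hψ, rfl⟩, hr⟩ :=
    exists_lt_of_csInf_lt (exists_isEmbeddingDist X Y) h
  obtain ⟨hH, hP⟩ := max_lt_iff.1 hr
  have hη : 0 < η := Metric.hausdorffDist_nonneg.trans_lt hH
  have hmφ := hφ.continuous.measurable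
  have hmψ := hψ.continuous.measurable
  have _ := Measure.isProbabilityMeasure_map (μ := X.measure) hmφ.aemeasurable
  have _ := Measure.isProbabilityMeasure_map (μ := Y.measure) hmψ.aemeasurable
  refine ciSup_le fun x => ?_
  obtain ⟨_, ⟨y, rfl⟩, hxy⟩ := Metric.exists_dist_lt_of_hausdorffDist_lt (mem_range_self x) hH
    (Metric.hausdorffEDist_ne_top_of_nonempty_of_bounded (range_nonempty φ) (range_nonempty ψ)
      (isCompact_range hφ.continuous).isBounded (isCompact_range hψ.continuous).isBounded)
  have hE : levyProkhorovEDist (X.measure.map φ) (Y.measure.map ψ) < ENNReal.ofReal η :=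
    (ENNReal.lt_ofReal_iff_toReal_lt (levyProkhorovEDist_ne_top _ _)).2 hP
  have hle := left_measure_le_of_levyProkhorovEDist_lt hE
    (Metric.isOpen_ball (x := φ x) (ε := δ)).measurableSet
  rw [ENNReal.toReal_ofReal hη.le, Measure.map_apply hmφ Metric.isOpen_ball.measurableSet,
    hφ.preimage_ball, Measure.map_apply hmψ Metric.isOpen_thickening.measurableSet] at hle
  have hsub : ψ ⁻¹' Metric.thickening η (Metric.ball (φ x) δ) ⊆ Metric.ball y δ' := by
    intro z hz
    obtain ⟨w, hw, hzw⟩ := Metric.mem_thickening_iff.1 hz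
    rw [Metric.mem_ball] at hw ⊢
    rw [← hψ.dist_eq]
    have := dist_triangle4 (ψ z) w (φ x) (ψ y)
    linarith
  have hreal := ENNReal.toReal_mono (by finiteness)
    (hle.trans (add_le_add (measure_mono hsub) le_rfl))
  rw [ENNReal.toReal_add (by finiteness) (by finiteness), ENNReal.toReal_ofReal hη.le] at hreal
  exact hreal.trans (add_le_add (measureReal_ball_le_largestBallMass δ' Y y) le_rfl)

/-- Outer regularity gives each point an open neighbourhood of mass below `ε`; a Lebesgue number of
this cover is the required `δ`. -/
theorem IsNonatomic.exists_largestBallMass_le {X : CompactMetricProbSpace.{u}}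
    (h : IsNonatomic X) {ε : ℝ} (hε : 0 < ε) : ∃ δ > 0, largestBallMass δ X ≤ ε := by
  have hU : ∀ x : X, ∃ U ⊇ {x}, IsOpen U ∧ X.measure U < ENNReal.ofReal ε := fun x =>
    Set.exists_isOpen_lt_of_lt {x} _ <| by
      rw [nonpos_iff_eq_zero.1 (not_lt.1 fun hx => h ⟨x, hx⟩)]
      exact ENNReal.ofReal_pos.2 hε
  choose U hxU hUo hUε using hU
  obtain ⟨δ, hδ, hball⟩ := lebesgue_number_lemma_of_metric isCompact_univ hUo
    fun x _ => mem_iUnion.2 ⟨x, hxU x rfl⟩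
  refine ⟨δ, hδ, ciSup_le fun x => ?_⟩
  obtain ⟨i, hi⟩ := hball x (mem_univ x)
  exact ENNReal.toReal_le_of_le_ofReal hε.le ((measure_mono hi).trans (hUε i).le)

theorem exists_le_largestBallMass_of_not_isNonatomic {X : CompactMetricProbSpace.{u}}
    (h : ¬ IsNonatomic X) : ∃ ε > 0, ∀ δ > 0, ε ≤ largestBallMass δ X := by
  obtain ⟨x, hx⟩ := not_not.1 h
  exact ⟨X.measure.real {x}, ENNReal.toReal_pos hx.ne' (by finiteness), fun δ hδ =>
    (measureReal_mono (singleton_subset_iff.2 (Metric.mem_ball_self hδ))).trans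
      (measureReal_ball_le_largestBallMass δ X x)⟩

end CompactMetricProbSpace

/-! ### Superlevel sets of the ball mass in `𝔎`. -/

namespace GHPSpace

theorem largestBallMass_mono {δ δ' : ℝ} (h : δ ≤ δ') (K : GHPSpace.{u}) :
    K.largestBallMass δ ≤ K.largestBallMass δ' := by
  induction K using Quotient.inductionOn with
  | h X => exact CompactMetricProbSpace.largestBallMass_mono h X

theorem largestBallMass_le_add_of_dist_lt {K L : GHPSpace.{u}} {δ δ' η : ℝ}
    (h : dist K L < η) (hδ : δ + 2 * η ≤ δ') :
    K.largestBallMass δ ≤ L.largestBallMass δ' + η := by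
  induction K using Quotient.inductionOn with
  | h X => induction L using Quotient.inductionOn with
    | h Y => exact CompactMetricProbSpace.largestBallMass_le_add_of_ghpDist_lt h hδ

theorem isNonatomic_iff {K : GHPSpace.{u}} :
    K.IsNonatomic ↔ ∀ ε > 0, ∃ δ > 0, K.largestBallMass δ ≤ ε := by
  induction K using Quotient.inductionOn with
  | h X =>
    refine ⟨fun h ε hε => CompactMetricProbSpace.IsNonatomic.exists_largestBallMass_le h hε,
      fun h => by_contra fun hX => ?_⟩
    obtain ⟨ε, hε, hle⟩ :=
      CompactMetricProbSpace.exists_le_largestBallMass_of_not_isNonatomic hX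
    obtain ⟨δ, hδ, hδε⟩ := h (ε / 2) (half_pos hε)
    have : ε ≤ ε / 2 := (hle δ hδ).trans hδε
    linarith

/-- This and the next lemma replace semicontinuity: passing to the closure or the interior costs an
arbitrarily small change of radius and level. -/
theorem lt_largestBallMass_of_mem_closure {K : GHPSpace.{u}} {δ δ' ε ε' : ℝ} (hδ : δ < δ')
    (hε : ε' < ε) (hK : K ∈ closure {L : GHPSpace.{u} | ε < L.largestBallMass δ}) :
    ε' < K.largestBallMass δ' := by
  -- The first term leaves room for the radius loss `2η`, the second for the mass loss `η`.
  have hη : 0 < min ((δ' - δ) / 2) (ε - ε') := lt_min (by linarith) (by linarith)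
  obtain ⟨L, hL, hKL⟩ := Metric.mem_closure_iff.1 hK _ hη
  rw [dist_comm] at hKL
  have := largestBallMass_le_add_of_dist_lt (δ := δ) (δ' := δ') hKL
    (by linarith [min_le_left ((δ' - δ) / 2) (ε - ε')])
  have hL' : ε < L.largestBallMass δ := hL
  linarith [min_le_right ((δ' - δ) / 2) (ε - ε')]

theorem mem_interior_of_lt_largestBallMass {K : GHPSpace.{u}} {δ δ' ε ε' : ℝ} (hδ : δ < δ')
    (hε : ε' < ε) (hK : ε < K.largestBallMass δ) :
    K ∈ interior {L : GHPSpace.{u} | ε' < L.largestBallMass δ'} := by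
  have hη : 0 < min ((δ' - δ) / 2) (ε - ε') := lt_min (by linarith) (by linarith)
  refine mem_interior_iff_mem_nhds.2 (Metric.mem_nhds_iff.2 ⟨_, hη, fun L hL => ?_⟩)
  rw [Metric.mem_ball'] at hL
  have := largestBallMass_le_add_of_dist_lt (δ := δ) (δ' := δ') hL
    (by linarith [min_le_left ((δ' - δ) / 2) (ε - ε')])
  change ε' < L.largestBallMass δ'
  linarith [min_le_right ((δ' - δ) / 2) (ε - ε')]

/-- The closures decrease with `δ`, and a space in all of them has `λ_δ > ε / 2` for every `δ > 0`,
hence an atom. Continuity from above of the law of `Z` concludes. -/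
theorem exists_map_closure_lt {Ω : Type*} [MeasurableSpace Ω] {μ : Measure Ω}
    [IsFiniteMeasure μ] {Z : Ω → GHPSpace.{u}} (hZ : AEMeasurable Z μ)
    (h : ∀ᵐ ω ∂μ, (Z ω).IsNonatomic) {ε : ℝ} (hε : 0 < ε) {r : ENNReal} (hr : 0 < r) :
    ∃ δ > 0, μ.map Z (closure {K : GHPSpace.{u} | ε < K.largestBallMass δ}) < r := by
  set C : ℕ → Set GHPSpace.{u} := fun k =>
    closure {K | ε < K.largestBallMass (1 / ((k : ℝ) + 1))}
  have hmC : ∀ k, MeasurableSet (C k) := fun k => isClosed_closure.measurableSet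
  have hC : Antitone C := fun k l hkl => closure_mono fun K (hK : ε < _) =>
    hK.trans_le (largestBallMass_mono (Nat.one_div_le_one_div hkl) K)
  have hzero : μ.map Z (⋂ k, C k) = 0 := by
    rw [Measure.map_apply_of_aemeasurable hZ (MeasurableSet.iInter hmC)]
    refine measure_mono_null (fun ω hω => ?_) (ae_iff.1 h)
    intro hna
    obtain ⟨δ, hδ, hle⟩ := isNonatomic_iff.1 hna (ε / 2) (half_pos hε)
    obtain ⟨k, hk⟩ := exists_nat_one_div_lt hδ
    exact hle.not_gt (lt_largestBallMass_of_mem_closure hk (half_lt_self hε) (mem_iInter.1 hω k))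
  have hlim := tendsto_measure_iInter_atTop (μ := μ.map Z)
    (fun k => (hmC k).nullMeasurableSet) hC ⟨0, by finiteness⟩
  rw [hzero] at hlim
  obtain ⟨k, hk⟩ := (hlim.eventually_lt_const hr).exists
  exact ⟨_, Nat.one_div_pos_of_nat, hk⟩

end GHPSpace

/-! ### Both implications by the portmanteau theorem. -/

theorem mainTheorem1 {Ω : ℕ → Type*} {Ω' : Type*} [∀ n, MeasurableSpace (Ω n)]
    [MeasurableSpace Ω'] (P : ∀ n, Measure (Ω n)) [∀ n, IsProbabilityMeasure (P n)]
    (P' : Measure Ω') [IsProbabilityMeasure P']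
    (X : ∀ n, Ω n → GHPSpace.{u}) (Z : Ω' → GHPSpace.{u})
    (hX : TendstoInDistribution X atTop Z P P') :
    (∀ᵐ ω ∂P', (Z ω).IsNonatomic) ↔
      ∀ ε > (0 : ℝ), ∀ ε' > (0 : ℝ), ∃ δ > (0 : ℝ), ∃ N > (0 : ℕ), ∀ n ≥ N,
        (P n).real {ω | ε < (X n ω).largestBallMass δ} < ε' := by
  have hmX := hX.forall_aemeasurable
  have hmZ := hX.aemeasurable_limit
  constructor
  · intro h ε hε ε' hε'
    obtain ⟨δ, hδ, hlt⟩ :=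
      GHPSpace.exists_map_closure_lt hmZ h hε (ENNReal.ofReal_pos.2 hε')
    have hlim := ProbabilityMeasure.limsup_measure_closed_le_of_tendsto hX.tendsto
      (isClosed_closure (s := {K : GHPSpace.{u} | ε < K.largestBallMass δ}))
    obtain ⟨N, hN⟩ := eventually_atTop.1 (eventually_lt_of_limsup_lt (hlim.trans_lt hlt))
    refine ⟨δ, hδ, N + 1, N.succ_pos, fun n hn => ?_⟩
    have hn' := hN n (by omega)
    rw [ProbabilityMeasure.coe_mk, Measure.map_apply_of_aemeasurable (hmX n)
      isClosed_closure.measurableSet] at hn'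
    have hsub : {ω | ε < (X n ω).largestBallMass δ} ⊆
        X n ⁻¹' closure {K | ε < K.largestBallMass δ} := fun ω hω => subset_closure hω
    exact (ENNReal.lt_ofReal_iff_toReal_lt (by finiteness)).1
      ((measure_mono hsub).trans_lt hn')
  · intro h
    -- Countably many levels suffice to detect atoms. The factor 2 leaves a gap above the level `1 /
    -- (m + 1)` used for the open set `G`.
    have hnull : ∀ m : ℕ, P' {ω | ∀ δ > 0, 2 / ((m : ℝ) + 1) < (Z ω).largestBallMass δ} = 0 := by
      intro m
      have hm : (0 : ℝ) < 1 / ((m : ℝ) + 1) := Nat.one_div_pos_of_nat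
      refine nonpos_iff_eq_zero.1 (ENNReal.le_of_forall_pos_le_add fun r hr _ => ?_)
      -- Here `δ` depends on `r`, which is harmless: the event in `hnull` concerns all `δ` at once,
      -- so it lies in `Z ⁻¹' G` for each choice.
      obtain ⟨δ, hδ, N, -, hN⟩ := h (1 / ((m : ℝ) + 1)) hm r hr
      set G := interior {K : GHPSpace.{u} | 1 / ((m : ℝ) + 1) < K.largestBallMass δ}
      have hG : IsOpen G := isOpen_interior
      have hlim := ProbabilityMeasure.le_liminf_measure_open_of_tendsto hX.tendsto hG
      have hsub : {ω | ∀ δ > 0, 2 / ((m : ℝ) + 1) < (Z ω).largestBallMass δ} ⊆ Z ⁻¹' G :=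
        fun ω hω => GHPSpace.mem_interior_of_lt_largestBallMass (half_lt_self hδ)
          (by rw [div_lt_div_iff_of_pos_right (by positivity)]; norm_num) (hω _ (half_pos hδ))
      rw [ProbabilityMeasure.coe_mk, Measure.map_apply_of_aemeasurable hmZ hG.measurableSet] at hlim
      rw [zero_add]
      -- The probabilities of `G` are at most `r` from `N` on, hence so is their liminf.
      refine (measure_mono hsub).trans (hlim.trans (liminf_le_of_frequently_le' ?_))
      refine (eventually_atTop.2 ⟨N, fun n hn => ?_⟩).frequently
      rw [ProbabilityMeasure.coe_mk, Measure.map_apply_of_aemeasurable (hmX n) hG.measurableSet]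
      have hsub' : X n ⁻¹' G ⊆ {ω | 1 / ((m : ℝ) + 1) < (X n ω).largestBallMass δ} :=
        preimage_mono (f := X n) interior_subset
      refine (measure_mono hsub').trans ?_
      rw [← ENNReal.ofReal_coe_nnreal]
      exact (ENNReal.le_ofReal_iff_toReal_le (by finiteness) r.2).2 (hN n hn).le
    filter_upwards [ae_all_iff.2 fun m => measure_eq_zero_iff_ae_notMem.1 (hnull m)] with ω hω
    refine GHPSpace.isNonatomic_iff.2 fun ε hε => ?_
    obtain ⟨m, hm⟩ := exists_nat_one_div_lt (half_pos hε)
    have hm' : 2 / ((m : ℝ) + 1) < ε := by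
      have : 2 / ((m : ℝ) + 1) = 2 * (1 / ((m : ℝ) + 1)) := by ring
      linarith
    have hω' := hω m
    simp only [not_forall, not_lt] at hω'
    obtain ⟨δ, hδ, hle⟩ := hω'
    exact ⟨δ, hδ, hle.trans hm'.le⟩
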